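/- Let $N\ge 3$ and $d\ge 2$, and let $\mathcal H=(\mathbb C^d)^{\otimes N}$, regarded as an $N$-partite system. Then no pure state (unit vector) $|\Phi\rangle\in\mathcal H$ is universal for local state discrimination in $\mathcal H$, and no pure state $|\Phi\rangle\in\mathcal H$ is universal for local unambiguous discrimination in $\mathcal H$. Here $\mathcal H\otimes\mathcal H$ is regarded as an $N$-partite system whose $k$-th local subsystem is $\mathbb C^{d}\otimes\mathbb C^{d}$ (the $k$-th factor of the first copy together with the $k$-th factor of the second). An LOCC measurement is a POVM that is implemented by a protocol of local measurements (with local ancillas) and classical communication between the $N$ parties, with finitely many or infinitely many rounds; in the latter case, the POVMs read off from the first $n$ rounds converge to it as $n\to\infty$. - $|\Phi\rangle$ is universal for local state discrimination in $\mathcal H$ if, for every non-empty set $\{|\psi_1\rangle,\dots,|\psi_n\rangle\}\subset\mathcal H$ of mutually orthogonal unit vectors, the states $|\Phi\rangle\otimes|\psi_i\rangle$ can be perfectly distinguished by LOCC: there is an LOCC measurement $\{\Pi_i\}_{i=1}^{n}$ with $\langle\Phi\otimes\psi_j|\Pi_i|\Phi\otimes\psi_j\rangle=\delta_{ij}$ for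 all $i,j$. - $|\Phi\rangle$ is universal for local unambiguous discrimination in $\mathcal H$ if, for every set $\{|\psi_1\rangle,\dots,|\psi_n\rangle\}\subset\mathcal H$ of linearly independent unit vectors, the states $|\Phi\rangle\otimes|\psi_i\rangle$ can be unambiguously distinguished by LOCC: there are an LOCC measurement $\{\Pi_i\}_{i=1}^{n+1}$ (outcome $n+1$ being inconclusive) and constants $\epsilon_i>0$ with $\langle\Phi\otimes\psi_j|\Pi_i|\Phi\otimes\psi_j\rangle=\delta_{ij}\epsilon_i$ for all $i,j\in\{1,\dots,n\}$. -/

import Mathlib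

open scoped Matrix Topology

/-- Amplitudes, in the standard product basis, of vectors of the `N`-partite Hilbert space
`⨂ₖ ℂ^(X k)`, where `X k` labels the standard basis of the `k`-th subsystem. The Euclidean
structure is the tensor product inner product. -/
abbrev MultiSpace {N : ℕ} (X : Fin N → Type) [∀ k, Fintype (X k)] : Type :=
  EuclideanSpace ℂ (∀ k, X k)

/-- `Φ ⊗ ψ`, regarded as a vector of the `N`-partite system whose `k`-th subsystem is
`ℂ^(X k) ⊗ ℂ^(Y k) = ℂ^(X k × Y k)`. -/
noncomputable def tensorState {N : ℕ} {X Y : Fin N → Type}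
    [∀ k, Fintype (X k)] [∀ k, Fintype (Y k)]
    (Φ : MultiSpace X) (ψ : MultiSpace Y) : MultiSpace (fun k => X k × Y k) :=
  WithLp.toLp 2 fun x => Φ (fun k => (x k).1) * ψ (fun k => (x k).2)

/-- The product operator `⨂ₖ A k` on `⨂ₖ ℂ^(X k)`. -/
noncomputable def tensorOp {N : ℕ} {X : Fin N → Type}
    (A : ∀ k, Matrix (X k) (X k) ℂ) : Matrix (∀ k, X k) (∀ k, X k) ℂ :=
  Matrix.of fun x y => ∏ k, A k (x k) (y k)

/-- The expectation value `⟨v| E |v⟩`. -/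
noncomputable def expectation {N : ℕ} {X : Fin N → Type} [∀ k, Fintype (X k)]
    (E : Matrix (∀ k, X k) (∀ k, X k) ℂ) (v : MultiSpace X) : ℂ :=
  star v.ofLp ⬝ᵥ (E *ᵥ v.ofLp)

/-- An LOCC protocol for `N` parties holding the system `⨂ₖ ℂ^(X k)`.

Every party first embeds its subsystem isometrically in a local workspace of arbitrary finite
dimension (it adjoins an ancilla in a fixed state). Then, round after round, one party measures
its own workspace and announces the outcome to all others. The public record of the outcomes so
far is a list, latest outcome first; both the party that acts next and the measurement it makes
may depend on the whole record. There is no bound on the number of rounds; a protocol of finitely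
many rounds is continued with trivial measurements (`card = 1`, `kraus = 1`). -/
structure LOCCProtocol {N : ℕ} (X : Fin N → Type)
    [∀ k, Fintype (X k)] [∀ k, DecidableEq (X k)] where
  /-- dimension of the local workspace of each party -/
  work : Fin N → ℕ
  /-- the embedding of each subsystem in its workspace -/
  init : ∀ k, Matrix (Fin (work k)) (X k) ℂ
  init_isometry : ∀ k, (init k)ᴴ * init k = 1
  /-- the party that acts next -/
  party : List ℕ → Fin N
  /-- the number of possible outcomes of its measurement -/
  card : List ℕ → ℕ
  /-- the measurement (Kraus) operators of its measurement -/
  kraus : ∀ h : List ℕ, ℕ → Matrix (Fin (work (party h))) (Fin (work (party h))) ℂ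
  complete : ∀ h, ∑ m ∈ Finset.range (card h), (kraus h m)ᴴ * kraus h m = 1

namespace LOCCProtocol

variable {N : ℕ} {X : Fin N → Type} [∀ k, Fintype (X k)] [∀ k, DecidableEq (X k)]

/-- The possible records after `n` rounds. -/
def records (P : LOCCProtocol X) : ℕ → Finset (List ℕ)
  | 0 => {[]}
  | n + 1 => (P.records n).biUnion fun h => (Finset.range (P.card h)).image fun m => m :: h

/-- The operator that has been applied by each party when the record is `h`. -/
noncomputable def localOp (P : LOCCProtocol X) :
    List ℕ → ∀ k, Matrix (Fin (P.work k)) (X k) ℂ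
  | [] => P.init
  | m :: h => Function.update (P.localOp h) (P.party h) (P.kraus h m * P.localOp h (P.party h))

/-- The measurement effect `⨂ₖ Aₖᴴ Aₖ` of the record `h`, where `⨂ₖ Aₖ` is the operator that
has been applied: on the input state `v` the record `h` occurs with probability
`⟨v| effect h |v⟩`. -/
noncomputable def effect (P : LOCCProtocol X) (h : List ℕ) :
    Matrix (∀ k, X k) (∀ k, X k) ℂ :=
  tensorOp fun k => (P.localOp h k)ᴴ * P.localOp h k

end LOCCProtocol

/-- `E` is a measurement (POVM) with outcomes in `O` that is implemented by LOCC: after `n` rounds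
the record `h` is read as the outcome `guess n h`, and the effects of the measurement so obtained
are, or converge to, the `E o`. They are equal to `E o` from some `n` on when the protocol has
finitely many rounds; the limit admits protocols with infinitely many rounds as well.
(`E o ≥ 0` and `∑ o, E o = 1` hold automatically.) -/
def IsLOCCMeasurement {N : ℕ} {X : Fin N → Type} [∀ k, Fintype (X k)] [∀ k, DecidableEq (X k)]
    {O : Type} [Fintype O] [DecidableEq O] (E : O → Matrix (∀ k, X k) (∀ k, X k) ℂ) : Prop :=
  ∃ (P : LOCCProtocol X) (guess : ℕ → List ℕ → O), ∀ o,
    Filter.Tendsto (fun n => ∑ h ∈ P.records n with guess n h = o, P.effect h)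
      Filter.atTop (𝓝 (E o))

/-- The states `v i` can be perfectly distinguished by LOCC. -/
def PerfectlyLOCCDistinguishable {N : ℕ} {X : Fin N → Type}
    [∀ k, Fintype (X k)] [∀ k, DecidableEq (X k)] {n : ℕ} (v : Fin n → MultiSpace X) : Prop :=
  ∃ E : Fin n → Matrix (∀ k, X k) (∀ k, X k) ℂ, IsLOCCMeasurement E ∧
    ∀ i j, expectation (E i) (v j) = if i = j then 1 else 0

/-- The states `v i` can be unambiguously distinguished by LOCC; the outcome `none` is the
inconclusive one. -/
def UnambiguouslyLOCCDistinguishable {N : ℕ} {X : Fin N → Type}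
    [∀ k, Fintype (X k)] [∀ k, DecidableEq (X k)] {n : ℕ} (v : Fin n → MultiSpace X) : Prop :=
  ∃ (E : Option (Fin n) → Matrix (∀ k, X k) (∀ k, X k) ℂ) (ε : Fin n → ℝ),
    IsLOCCMeasurement E ∧ (∀ i, 0 < ε i) ∧
    ∀ i j, expectation (E (some i)) (v j) = if i = j then (ε i : ℂ) else 0

/-- `Φ ∈ ⨂ₖ ℂ^(d' k)` is universal for local (perfect) state discrimination in `⨂ₖ ℂ^(d k)`:
for every non-empty set of mutually orthogonal states `ψ i`, the states `Φ ⊗ ψ i` can be perfectly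
distinguished by LOCC. -/
def UniversalForDiscrimination {N : ℕ} {d' : Fin N → ℕ} (d : Fin N → ℕ)
    (Φ : MultiSpace fun k => Fin (d' k)) : Prop :=
  ∀ (n : ℕ) (ψ : Fin n → MultiSpace fun k => Fin (d k)), 0 < n → Orthonormal ℂ ψ →
    PerfectlyLOCCDistinguishable fun i => tensorState Φ (ψ i)

/-- `Φ ∈ ⨂ₖ ℂ^(d' k)` is universal for local unambiguous discrimination in `⨂ₖ ℂ^(d k)`:
for every set of linearly independent states `ψ i`, the states `Φ ⊗ ψ i` can be unambiguously
distinguished by LOCC. -/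
def UniversalForUnambiguousDiscrimination {N : ℕ} {d' : Fin N → ℕ} (d : Fin N → ℕ)
    (Φ : MultiSpace fun k => Fin (d' k)) : Prop :=
  ∀ (n : ℕ) (ψ : Fin n → MultiSpace fun k => Fin (d k)),
    (∀ i, ‖ψ i‖ = 1) → LinearIndependent ℂ ψ →
    UnambiguouslyLOCCDistinguishable fun i => tensorState Φ (ψ i)

/-! Either kind of universality gives, for each orthonormal basis `b` and index `i`, an LOCC effect
that annihilates `Φ ⊗ b j` for `j ≠ i` but not `Φ ⊗ b i`. Finite-round LOCC effects have
expectations that are sums of squared moduli of product functionals, and a compactness bound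
survives the limit, so a single product functional separates likewise
(`exists_productForm_of_isLOCCMeasurement`). Read as a product operator from the first copy to the
second, it sends `Φ` to a nonzero multiple of the conjugate of `b i`, which can be any direction.

For three or more parties this is impossible. Reaching GHZ forces invertible local operators, so
every vector would be a product-operator image of GHZ, hence of tensor rank at most `d`; a nilpotent
pencil has larger rank. -/

theorem tensorOp_one {N : ℕ} {X : Fin N → Type} [∀ k, DecidableEq (X k)] :
    tensorOp (fun k => (1 : Matrix (X k) (X k) ℂ)) = 1 := by
  ext x y
  simp only [tensorOp, Matrix.of_apply, Matrix.one_apply, Finset.prod_ite_zero, funext_iff]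
  simp

/-! ### Product functionals and limits of LOCC effects -/

section ProductForms

variable {N : ℕ} {X : Fin N → Type} [∀ k, Fintype (X k)]

/-- The product functional `⨂ₖ a k` on `⨂ₖ ℂ^(X k)`. -/
noncomputable def productForm (a : ∀ k, X k → ℂ) (v : (∀ k, X k) → ℂ) : ℂ :=
  ∑ y, (∏ k, a k (y k)) * v y

/-- The effect is the Gram matrix of `⨂ₖ A k`, whose rows are product functionals. -/
theorem expectation_tensorOp_conjTranspose_mul_self {w : Fin N → ℕ}
    (A : ∀ k, Matrix (Fin (w k)) (X k) ℂ) (v : MultiSpace X) :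
    expectation (tensorOp fun k => (A k)ᴴ * A k) v =
      ((∑ z : ∀ k, Fin (w k), ‖productForm (fun k => A k (z k)) v.ofLp‖ ^ 2 : ℝ) : ℂ) := by
  set B : Matrix (∀ k, Fin (w k)) (∀ k, X k) ℂ := Matrix.of fun z y => ∏ k, A k (z k) (y k)
    with hB
  have hBB : (tensorOp fun k => (A k)ᴴ * A k) = Bᴴ * B := by
    ext x y
    simp only [tensorOp, hB, Matrix.of_apply, Matrix.mul_apply, Matrix.conjTranspose_apply]
    rw [Finset.prod_univ_sum, Fintype.piFinset_univ]
    refine Finset.sum_congr rfl fun z _ => ?_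
    rw [Finset.prod_mul_distrib, star_prod]
  have hv : ∀ z, (B *ᵥ v.ofLp) z = productForm (fun k => A k (z k)) v.ofLp := fun z => rfl
  rw [expectation, hBB, ← Matrix.mulVec_mulVec, Matrix.dotProduct_mulVec,
    ← Matrix.star_mulVec, dotProduct, Complex.ofReal_sum]
  refine Finset.sum_congr rfl fun z _ => ?_
  rw [← hv, Pi.star_apply]
  simpa using Complex.conj_mul' ((B *ᵥ v.ofLp) z)

theorem expectation_sum {ι : Type} (s : Finset ι) (E : ι → Matrix (∀ k, X k) (∀ k, X k) ℂ)
    (v : MultiSpace X) : expectation (∑ h ∈ s, E h) v = ∑ h ∈ s, expectation (E h) v := by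
  simp only [expectation, Matrix.sum_mulVec, dotProduct_sum]

theorem continuous_expectation (v : MultiSpace X) :
    Continuous fun E : Matrix (∀ k, X k) (∀ k, X k) ℂ => expectation E v := by
  unfold expectation
  fun_prop

theorem continuous_productForm (v : (∀ k, X k) → ℂ) :
    Continuous fun a : ∀ k, EuclideanSpace ℂ (X k) => productForm (fun k => (a k).ofLp) v := by
  unfold productForm
  fun_prop

theorem productForm_smul (c : Fin N → ℂ) (a : ∀ k, X k → ℂ) (v : (∀ k, X k) → ℂ) :
    productForm (fun k => c k • a k) v = (∏ k, c k) * productForm a v := by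
  simp only [productForm, Pi.smul_apply, smul_eq_mul, Finset.prod_mul_distrib, Finset.mul_sum,
    mul_assoc]

/-- Turns the norm factor of the compactness bound into a trace, which is linear in the effect and
so passes to the limit. -/
theorem sum_norm_productForm_single [∀ k, DecidableEq (X k)] (a : ∀ k, EuclideanSpace ℂ (X k)) :
    ∑ y : ∀ k, X k, ‖productForm (fun k => (a k).ofLp) (Pi.single y 1)‖ ^ 2
      = ∏ k, ‖a k‖ ^ 2 := by
  simp only [EuclideanSpace.norm_sq_eq]
  rw [Finset.prod_univ_sum, Fintype.piFinset_univ]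
  refine Finset.sum_congr rfl fun y _ => ?_
  simp [productForm, Pi.single_apply, Finset.prod_pow]

/-- If a product functional vanishes at `u` whenever it vanishes at all `v j`, then this implication
holds quantitatively. -/
theorem exists_norm_productForm_le {ι : Type} (s : Finset ι) (u : (∀ k, X k) → ℂ)
    (v : ι → (∀ k, X k) → ℂ)
    (h : ∀ a : ∀ k, X k → ℂ, (∀ j ∈ s, productForm a (v j) = 0) → productForm a u = 0)
    {ε : ℝ} (hε : 0 < ε) :
    ∃ C : ℝ, ∀ a : ∀ k, EuclideanSpace ℂ (X k),
      ‖productForm (fun k => (a k).ofLp) u‖ ^ 2 ≤ ε * ∏ k, ‖a k‖ ^ 2 +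
        C * ∑ j ∈ s, ‖productForm (fun k => (a k).ofLp) (v j)‖ ^ 2 := by
  set q : (∀ k, EuclideanSpace ℂ (X k)) → ℝ := fun a =>
    ∑ j ∈ s, ‖productForm (fun k => (a k).ofLp) (v j)‖ ^ 2 with hq
  have hq0 : ∀ a, 0 ≤ q a := fun a => Finset.sum_nonneg fun j _ => by positivity
  have hqc : Continuous q :=
    continuous_finsetSum _ fun j _ => ((continuous_productForm (v j)).norm.pow 2)
  have hK : IsCompact (Set.univ.pi fun k => Metric.sphere (0 : EuclideanSpace ℂ (X k)) 1) :=
    isCompact_univ_pi fun k => isCompact_sphere _ _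
  -- These open sets increase with `n` and cover the product of unit spheres, so one `n` serves as
  -- `C`.
  obtain ⟨n, hn⟩ := hK.elim_directed_cover
    (fun n : ℕ => {a | ‖productForm (fun k => (a k).ofLp) u‖ ^ 2 < ε + n * q a})
    (fun n => isOpen_lt ((continuous_productForm u).norm.pow 2)
      (continuous_const.add (continuous_const.mul hqc)))
    (fun a _ => by
      rw [Set.mem_iUnion]
      rcases (hq0 a).eq_or_lt with h0 | h0
      · refine ⟨0, ?_⟩
        have := (Finset.sum_eq_zero_iff_of_nonneg (fun j _ => by positivity)).1 h0.symm
        have hu := h (fun k => (a k).ofLp) fun j hj => by simpa using this j hj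
        simpa [hu] using hε
      · obtain ⟨n, hn⟩ := exists_nat_gt (‖productForm (fun k => (a k).ofLp) u‖ ^ 2 / q a)
        refine ⟨n, ?_⟩
        have := (div_lt_iff₀ h0).1 hn
        simp only [Set.mem_ofPred_eq]
        linarith)
    (directed_of_isDirected_le fun m n hmn a ha => by
      have : (m : ℝ) * q a ≤ n * q a :=
        mul_le_mul_of_nonneg_right (by exact_mod_cast hmn) (hq0 a)
      simp only [Set.mem_ofPred_eq] at ha ⊢
      linarith)
  refine ⟨n, fun a => ?_⟩
  -- The general case follows by homogeneity in each factor; a zero factor kills the left side.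
  by_cases ha : ∃ k, a k = 0
  · obtain ⟨k, hk⟩ := ha
    have h0 : productForm (fun k => (a k).ofLp) u = 0 :=
      Finset.sum_eq_zero fun y _ => by
        rw [Finset.prod_eq_zero (Finset.mem_univ k) (by simp [hk]), zero_mul]
    rw [h0]
    have hp : 0 ≤ ∏ k, ‖a k‖ ^ 2 := Finset.prod_nonneg fun k _ => by positivity
    have hq : 0 ≤ n * q a := mul_nonneg n.cast_nonneg (hq0 a)
    change _ ≤ _ + _ * q a
    rw [norm_zero]
    nlinarith [mul_nonneg hε.le hp]
  · push Not at ha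
    set b : ∀ k, EuclideanSpace ℂ (X k) := fun k => ((‖a k‖⁻¹ : ℝ) : ℂ) • a k with hb
    have hmem : b ∈ Set.univ.pi fun k => Metric.sphere (0 : EuclideanSpace ℂ (X k)) 1 := by
      intro k _
      simp [hb, norm_smul, ha k]
    have hab : ∀ w, ‖productForm (fun k => (a k).ofLp) w‖ ^ 2 =
        (∏ k, ‖a k‖ ^ 2) * ‖productForm (fun k => (b k).ofLp) w‖ ^ 2 := by
      intro w
      have hsm : (fun k => (a k).ofLp) = fun k => ((‖a k‖ : ℝ) : ℂ) • (b k).ofLp := by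
        funext k
        have : ((‖a k‖ : ℝ) : ℂ) ≠ 0 := by simpa using ha k
        simp [hb, smul_smul, this]
      rw [hsm, productForm_smul, norm_mul, mul_pow, norm_prod, Finset.prod_pow]
      simp
    have hbn := hn hmem
    rw [Set.mem_ofPred_eq] at hbn
    have hqa : q a = (∏ k, ‖a k‖ ^ 2) * q b := by
      simp only [hq, Finset.mul_sum, hab]
    change _ ≤ _ + _ * q a
    rw [hab, hqa]
    have hp : 0 ≤ ∏ k, ‖a k‖ ^ 2 := Finset.prod_nonneg fun k _ => by positivity
    have := mul_le_mul_of_nonneg_left hbn.le hp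
    linarith

/-- If an LOCC effect annihilates all `v j` but not `u`, so does some product functional. -/
theorem exists_productForm_of_isLOCCMeasurement [∀ k, DecidableEq (X k)] {O : Type} [Fintype O]
    [DecidableEq O] {E : O → Matrix (∀ k, X k) (∀ k, X k) ℂ} (hE : IsLOCCMeasurement E) (o : O)
    {ι : Type} (s : Finset ι) (u : MultiSpace X) (v : ι → MultiSpace X)
    (hu : 0 < (expectation (E o) u).re) (hv : ∀ j ∈ s, expectation (E o) (v j) = 0) :
    ∃ a : ∀ k, X k → ℂ, (∀ j ∈ s, productForm a (v j).ofLp = 0) ∧ productForm a u.ofLp ≠ 0 := by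
  obtain ⟨P, guess, hP⟩ := hE
  by_contra! hcon
  set F : ℕ → Matrix (∀ k, X k) (∀ k, X k) ℂ := fun n =>
    ∑ h ∈ P.records n with guess n h = o, P.effect h with hF
  have hlim : ∀ w : MultiSpace X, Filter.Tendsto (fun n => (expectation (F n) w).re)
      Filter.atTop (𝓝 (expectation (E o) w).re) := fun w =>
    ((Complex.continuous_re.comp (continuous_expectation w)).tendsto _).comp (hP o)
  have hexp : ∀ n (w : MultiSpace X), (expectation (F n) w).re =
      ∑ h ∈ P.records n with guess n h = o, ∑ z : ∀ k, Fin (P.work k),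
        ‖productForm (fun k => P.localOp h k (z k)) w.ofLp‖ ^ 2 := by
    intro n w
    simp only [hF, expectation_sum, LOCCProtocol.effect,
      expectation_tensorOp_conjTranspose_mul_self, ← Complex.ofReal_sum, Complex.ofReal_re]
  set e : (∀ k, X k) → MultiSpace X := fun y => WithLp.toLp 2 (Pi.single y 1) with he
  -- The sum on the right is the trace of `E o`. `C` depends on `ε` but not on the round, so its
  -- term vanishes in the limit.
  have hbound : ∀ ε : ℝ, 0 < ε →
      (expectation (E o) u).re ≤ ε * ∑ y, (expectation (E o) (e y)).re := by
    intro ε hε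
    obtain ⟨C, hC⟩ := exists_norm_productForm_le s u.ofLp (fun j => (v j).ofLp) hcon hε
    have hn : ∀ n, (expectation (F n) u).re ≤ ε * ∑ y, (expectation (F n) (e y)).re +
        C * ∑ j ∈ s, (expectation (F n) (v j)).re := by
      intro n
      simp only [hexp]
      have hcomm : ∀ {κ : Type} (t : Finset κ) (f : List ℕ → (∀ k, Fin (P.work k)) → κ → ℝ),
          ∑ h ∈ P.records n with guess n h = o, ∑ z, ∑ y ∈ t, f h z y =
            ∑ y ∈ t, ∑ h ∈ P.records n with guess n h = o, ∑ z, f h z y := fun t f =>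
        (Finset.sum_congr rfl fun h _ => Finset.sum_comm).trans Finset.sum_comm
      rw [← hcomm, ← hcomm]
      simp only [Finset.mul_sum _ _ ε, Finset.mul_sum _ _ C, ← Finset.sum_add_distrib]
      refine Finset.sum_le_sum fun h _ => Finset.sum_le_sum fun z _ => ?_
      have := hC fun k => WithLp.toLp 2 (P.localOp h k (z k))
      rw [← sum_norm_productForm_single] at this
      simpa only [Finset.mul_sum] using this
    have := le_of_tendsto_of_tendsto' (hlim u)
      (((tendsto_finsetSum _ fun y _ => hlim (e y)).const_mul ε).add
        ((tendsto_finsetSum _ fun j _ => hlim (v j)).const_mul C)) hn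
    rwa [Finset.sum_eq_zero (s := s) fun j hj => by rw [hv j hj, Complex.zero_re], mul_zero,
      add_zero] at this
  generalize ∑ y, (expectation (E o) (e y)).re = t at hbound
  generalize (expectation (E o) u).re = p at hu hbound
  have h1 := hbound 1 one_pos
  have ht : 0 < t := by linarith
  -- With this `ε` the bound reads `p ≤ p / 2`.
  have h2 := hbound (p / (2 * t)) (by positivity)
  rw [div_mul_eq_mul_div, le_div_iff₀ (by positivity)] at h2
  nlinarith [mul_pos hu ht]

/-! ### From discrimination to product transformations -/

theorem productForm_tensorState (a : ∀ k, X k × X k → ℂ) (Φ ψ : MultiSpace X) :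
    productForm a (tensorState Φ ψ).ofLp =
      (tensorOp (fun k => Matrix.of fun z y => a k (y, z)) *ᵥ Φ.ofLp) ⬝ᵥ ψ.ofLp := by
  rw [productForm, ← (Equiv.arrowProdEquivProdArrow (Fin N) X X).symm.sum_comp,
    Fintype.sum_prod_type_right]
  simp only [dotProduct, Matrix.mulVec, tensorOp, Matrix.of_apply, Finset.sum_mul]
  refine Finset.sum_congr rfl fun z _ => Finset.sum_congr rfl fun y _ => ?_
  simp only [tensorState, Equiv.arrowProdEquivProdArrow, Equiv.coe_fn_symm_mk]
  ring

theorem tensorOp_mul (A B : ∀ k, Matrix (X k) (X k) ℂ) :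
    tensorOp A * tensorOp B = tensorOp fun k => A k * B k := by
  ext x y
  simp only [tensorOp, Matrix.of_apply, Matrix.mul_apply]
  rw [Finset.prod_univ_sum, Fintype.piFinset_univ]
  exact Finset.sum_congr rfl fun z _ => Finset.prod_mul_distrib.symm

/-- A resource that allows every orthonormal basis to be discriminated unambiguously by LOCC can be
transformed by product operators into any vector. -/
theorem exists_tensorOp_mulVec_eq_smul [∀ k, DecidableEq (X k)] (Φ : MultiSpace X)
    (hΦ : ∀ (n : ℕ) (ψ : Fin n → MultiSpace X) (i : Fin n), Orthonormal ℂ ψ →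
      ∃ (O : Type) (_ : Fintype O) (_ : DecidableEq O)
        (E : O → Matrix (∀ k, X k × X k) (∀ k, X k × X k) ℂ) (o : O), IsLOCCMeasurement E ∧
        0 < (expectation (E o) (tensorState Φ (ψ i))).re ∧
        ∀ j, j ≠ i → expectation (E o) (tensorState Φ (ψ j)) = 0)
    (φ : (∀ k, X k) → ℂ) (hφ : φ ≠ 0) :
    ∃ (B : ∀ k, Matrix (X k) (X k) ℂ) (c : ℂ), c ≠ 0 ∧ tensorOp B *ᵥ Φ.ofLp = c • φ := by
  -- The conjugate is needed because `productForm_tensorState` pairs bilinearly: it is `star` of the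
  -- image of `Φ` that is orthogonal to the other basis vectors.
  set u : MultiSpace X := WithLp.toLp 2 (star φ) with hu
  have hu0 : u ≠ 0 := fun h => hφ (by simpa [hu] using h)
  set w : MultiSpace X := ((‖u‖⁻¹ : ℝ) : ℂ) • u with hw
  have hw1 : ‖w‖ = 1 := by
    have : ‖u‖ ≠ 0 := by simpa using hu0
    simp [hw, norm_smul, this]
  have hpos : 0 < Module.finrank ℂ (MultiSpace X) :=
    Module.finrank_pos_iff_exists_ne_zero.2 ⟨u, hu0⟩
  set n := Module.finrank ℂ (MultiSpace X) with hn
  set i : Fin n := ⟨0, hpos⟩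
  obtain ⟨b, hb⟩ := Orthonormal.exists_orthonormalBasis_extension_of_card_eq (𝕜 := ℂ)
    (E := MultiSpace X) (ι := Fin n) (by simp [hn]) (v := fun _ => w) (s := {i})
    ⟨fun _ => hw1, fun x y hxy => absurd (Subsingleton.elim x y) hxy⟩
  have hbi : b i = w := hb i rfl
  obtain ⟨O, _, _, E, o, hE, hp, h0⟩ := hΦ n b i b.orthonormal
  obtain ⟨a, ha0, ha⟩ := exists_productForm_of_isLOCCMeasurement hE o (Finset.univ.erase i) _
    (fun j => tensorState Φ (b j)) hp fun j hj => h0 j (Finset.ne_of_mem_erase hj)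
  simp only [productForm_tensorState] at ha0 ha
  set B : ∀ k, Matrix (X k) (X k) ℂ := fun k => Matrix.of fun z y => a k (y, z)
  set g : MultiSpace X := WithLp.toLp 2 (star (tensorOp B *ᵥ Φ.ofLp)) with hg
  have hinner : ∀ j, inner ℂ g (b j) = (tensorOp B *ᵥ Φ.ofLp) ⬝ᵥ (b j).ofLp := by
    intro j
    rw [EuclideanSpace.inner_eq_star_dotProduct, hg, star_star, dotProduct_comm]
  have hgw : g = inner ℂ (b i) g • w := by
    conv_lhs => rw [← b.sum_repr' g]
    rw [Finset.sum_eq_single i, hbi]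
    · intro j _ hj
      rw [← inner_conj_symm, hinner, ha0 j (Finset.mem_erase.2 ⟨hj, Finset.mem_univ _⟩)]
      simp
    · simp
  have hne : inner ℂ (b i) g ≠ 0 := by
    rw [← inner_conj_symm, hinner]
    simpa using ha
  refine ⟨B, star (inner ℂ (b i) g * ((‖u‖⁻¹ : ℝ) : ℂ)), ?_, ?_⟩
  · exact star_ne_zero.2 (mul_ne_zero hne (by simpa using hu0))
  · have := congrArg (fun v : MultiSpace X => star v.ofLp) hgw
    rw [hw, smul_smul] at this
    simpa only [hg, hu, WithLp.ofLp_smul, star_smul, star_star] using this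

end ProductForms

/-! ### GHZ and the tensor rank of a nilpotent pencil -/

section TensorRank

variable {N d : ℕ}

/-- The unnormalised GHZ state. -/
def ghz (N d : ℕ) (z : Fin N → Fin d) : ℂ := if ∀ k l, z k = z l then 1 else 0

/-- Contracting party `k` of GHZ with `v`, all other indices being `j`, leaves `v j`; a left kernel
vector of `B k` makes every such contraction vanish. -/
theorem isUnit_of_tensorOp_mulVec_eq_smul_ghz (hN : 2 ≤ N) {B : Fin N → Matrix (Fin d) (Fin d) ℂ}
    {Φ : (Fin N → Fin d) → ℂ} {c : ℂ} (hc : c ≠ 0) (h : tensorOp B *ᵥ Φ = c • ghz N d)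
    (k : Fin N) : IsUnit (B k) := by
  rw [← Matrix.vecMul_injective_iff_isUnit]
  change Function.Injective (B k).vecMulLinear
  rw [← LinearMap.ker_eq_bot, LinearMap.ker_eq_bot']
  intro v hv
  replace hv : v ᵥ* B k = 0 := hv
  obtain ⟨l, hl⟩ : ∃ l : Fin N, l ≠ k :=
    have : Nontrivial (Fin N) := Fin.nontrivial_iff_two_le.2 hN
    exists_ne k
  ext j
  have hsum : ∑ t, v t * (c • ghz N d) (Function.update (fun _ => j) k t) = 0 := by
    simp only [← h, Matrix.mulVec, dotProduct, tensorOp, Matrix.of_apply, Finset.mul_sum]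
    rw [Finset.sum_comm]
    refine Finset.sum_eq_zero fun y _ => ?_
    have : ∀ t, v t * ((∏ m, B m (Function.update (fun _ => j) k t m) (y m)) * Φ y) =
        v t * B k t (y k) * ((∏ m ∈ Finset.univ.erase k, B m j (y m)) * Φ y) := by
      intro t
      rw [← Finset.mul_prod_erase _ _ (Finset.mem_univ k), Function.update_self,
        Finset.prod_congr rfl fun m hm => by
          rw [Function.update_of_ne (Finset.ne_of_mem_erase hm)]]
      ring
    rw [Finset.sum_congr rfl fun t _ => this t, ← Finset.sum_mul]
    have := congrFun hv (y k)
    simp only [Matrix.vecMul, dotProduct, Pi.zero_apply] at this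
    rw [this, zero_mul]
  rw [Finset.sum_eq_single j] at hsum
  · simpa [ghz, hc] using hsum
  · intro t _ ht
    have : ghz N d (Function.update (fun _ => j) k t) = 0 := by
      rw [ghz, if_neg]
      intro H
      have := H k l
      rw [Function.update_self, Function.update_of_ne hl] at this
      exact ht this
    simp [this]
  · simp

/-- Exhibits the image as a sum of `d` product vectors built from the columns of the `C k`. -/
theorem tensorOp_mulVec_ghz (hN : 0 < N) (C : Fin N → Matrix (Fin d) (Fin d) ℂ)
    (z : Fin N → Fin d) :
    (tensorOp C *ᵥ ghz N d) z = ∑ i, ∏ k, C k (z k) i := by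
  simp only [Matrix.mulVec, dotProduct, tensorOp, Matrix.of_apply, ghz, mul_ite, mul_one, mul_zero]
  rw [← Finset.sum_filter]
  symm
  refine Finset.sum_bij (fun i _ => fun _ => i) (by simp) ?_ ?_ ?_
  · intro i _ j _ hij
    exact congrFun hij ⟨0, hN⟩
  · intro y hy
    refine ⟨y ⟨0, hN⟩, Finset.mem_univ _, ?_⟩
    funext k
    exact (Finset.mem_filter.1 hy).2 _ _
  · intro i _
    rfl

/-- A pencil of `d × d` matrices spanned by the identity and a nonzero nilpotent matrix is not
simultaneously diagonalisable, so the corresponding tensor has rank larger than `d`. -/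
theorem eq_zero_of_simultaneously_diagonal {ι : Type} [Fintype ι] [DecidableEq ι]
    {U V M : Matrix ι ι ℂ} {p q : ι → ℂ} {c : ℂ} (hc : c ≠ 0)
    (h1 : U * Matrix.diagonal p * V = c • 1) (hM : U * Matrix.diagonal q * V = M)
    (hMM : M * M = 0) : M = 0 := by
  have hUV : (c⁻¹ • (U * Matrix.diagonal p)) * V = 1 := by
    rw [Matrix.smul_mul, h1, smul_smul, inv_mul_cancel₀ hc, one_smul]
  -- So `V * U` is a multiple of the inverse of `diagonal p`, hence commutes with `diagonal q`, and
  -- `M * M = 0` reduces to `diagonal q` squaring to zero.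
  have hVU : V * U * Matrix.diagonal p = c • 1 := by
    have := mul_eq_one_comm.1 hUV
    rw [Matrix.mul_smul, inv_smul_eq_iff₀ hc] at this
    rw [mul_assoc, this]
  have hUV' : U * (c⁻¹ • (Matrix.diagonal p * V)) = 1 := by
    rw [Matrix.mul_smul, ← mul_assoc, h1, smul_smul, inv_mul_cancel₀ hc, one_smul]
  have hUl := mul_eq_one_comm.1 hUV'
  have hVr := mul_eq_one_comm.1 hUV
  have hq : Matrix.diagonal q * (V * U) * Matrix.diagonal q = 0 := by
    have : (c⁻¹ • (Matrix.diagonal p * V)) * (M * M) * (c⁻¹ • (U * Matrix.diagonal p)) = 0 := by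
      rw [hMM, mul_zero, zero_mul]
    calc Matrix.diagonal q * (V * U) * Matrix.diagonal q
        = ((c⁻¹ • (Matrix.diagonal p * V)) * U) * Matrix.diagonal q * (V * U) *
          Matrix.diagonal q * (V * (c⁻¹ • (U * Matrix.diagonal p))) := by
            rw [hUl, hVr, one_mul, mul_one]
      _ = (c⁻¹ • (Matrix.diagonal p * V)) * (M * M) * (c⁻¹ • (U * Matrix.diagonal p)) := by
            rw [← hM]; simp only [mul_assoc]
      _ = 0 := this
  have hqq : Matrix.diagonal q * Matrix.diagonal q = 0 := by
    have : c • (Matrix.diagonal q * Matrix.diagonal q) = 0 := by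
      calc c • (Matrix.diagonal q * Matrix.diagonal q)
          = Matrix.diagonal q * (V * U * Matrix.diagonal p) * Matrix.diagonal q := by
            rw [hVU]; simp
        _ = Matrix.diagonal q * (V * U) * (Matrix.diagonal p * Matrix.diagonal q) := by
            simp only [mul_assoc]
        _ = Matrix.diagonal q * (V * U) * Matrix.diagonal q * Matrix.diagonal p := by
            rw [Matrix.diagonal_mul_diagonal' p q, mul_assoc _ (Matrix.diagonal q),
              Matrix.diagonal_mul_diagonal' q p]
            simp only [mul_comm]
        _ = 0 := by rw [hq, zero_mul]
    exact (smul_eq_zero.1 this).resolve_left hc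
  have : q = 0 := by
    funext i
    rw [Matrix.diagonal_mul_diagonal] at hqq
    simpa using congrFun (congrFun hqq i) i
  rw [← hM, this]
  simp

/-- The tensor of three parties whose slices are the identity and `M`; the other parties are in a
product state. -/
def pencil [NeZero d] (M : Matrix (Fin d) (Fin d) ℂ) (k₀ k₁ k₂ : Fin N) (z : Fin N → Fin d) : ℂ :=
  (if z k₂ = 0 then 1 else M) (z k₀) (z k₁)

/-- Setting all indices except those of `k₀`, `k₁` to `t` turns the rank decomposition into a
simultaneous diagonalisation of the slices; `t = 0` and `t = 1` give the identity and `M`. -/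
theorem tensorOp_mulVec_ghz_ne_smul_pencil (hd : 2 ≤ d) [NeZero d] {k₀ k₁ k₂ : Fin N}
    (h01 : k₀ ≠ k₁) (h02 : k₀ ≠ k₂) (h12 : k₁ ≠ k₂) {M : Matrix (Fin d) (Fin d) ℂ} (hM : M ≠ 0)
    (hMM : M * M = 0) (C : Fin N → Matrix (Fin d) (Fin d) ℂ) {c : ℂ} (hc : c ≠ 0) :
    tensorOp C *ᵥ ghz N d ≠ c • pencil M k₀ k₁ k₂ := by
  intro h
  set r : Fin d → Fin d → ℂ := fun t i => ∏ k ∈ (Finset.univ.erase k₀).erase k₁, C k t i with hr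
  have key : ∀ t, C k₀ * Matrix.diagonal (r t) * (C k₁)ᵀ = c • (if t = 0 then 1 else M) := by
    intro t
    ext a b
    have := congrFun h fun k => if k = k₀ then a else if k = k₁ then b else t
    rw [tensorOp_mulVec_ghz k₀.pos] at this
    simp only [Pi.smul_apply, pencil, h02.symm, h12.symm, h01.symm, if_true, if_false] at this
    rw [Matrix.smul_apply, ← this, Matrix.mul_apply]
    refine Finset.sum_congr rfl fun i _ => ?_
    rw [Matrix.mul_diagonal, Matrix.transpose_apply,
      ← Finset.mul_prod_erase _ _ (Finset.mem_univ k₀),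
      ← Finset.mul_prod_erase _ _ (Finset.mem_erase.2 ⟨h01.symm, Finset.mem_univ k₁⟩),
      Finset.prod_congr rfl fun k hk => by
        rw [if_neg (Finset.ne_of_mem_erase (Finset.mem_of_mem_erase hk)),
          if_neg (Finset.ne_of_mem_erase hk)]]
    simp only [hr, h01.symm, if_true, if_false]
    ring
  have hone : (⟨1, hd⟩ : Fin d) ≠ 0 := by simp [Fin.ext_iff]
  have h0 := key 0
  have h1 := key ⟨1, hd⟩
  rw [if_pos rfl] at h0
  rw [if_neg hone] at h1
  have := eq_zero_of_simultaneously_diagonal hc h0 h1 (by simp [hMM])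
  exact hM ((smul_eq_zero.1 this).resolve_left hc)

end TensorRank

/-- For three or more parties no tensor is transformed by product operators into all others. -/
theorem not_forall_exists_tensorOp_mulVec_eq_smul {N d : ℕ} (hN : 3 ≤ N) (hd : 2 ≤ d)
    (Φ : (Fin N → Fin d) → ℂ) :
    ¬ ∀ φ : (Fin N → Fin d) → ℂ, φ ≠ 0 →
      ∃ (B : Fin N → Matrix (Fin d) (Fin d) ℂ) (c : ℂ), c ≠ 0 ∧ tensorOp B *ᵥ Φ = c • φ := by
  intro H
  have : NeZero d := ⟨by omega⟩
  obtain ⟨B, b, hb, hB⟩ := H (ghz N d) fun h => by simpa [ghz] using congrFun h 0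
  have hunit := isUnit_of_tensorOp_mulVec_eq_smul_ghz (by omega) hb hB
  set M : Matrix (Fin d) (Fin d) ℂ := Matrix.single 0 ⟨1, hd⟩ 1 with hM
  have hone : (⟨1, hd⟩ : Fin d) ≠ 0 := by simp [Fin.ext_iff]
  set k₀ : Fin N := ⟨0, by omega⟩
  set k₁ : Fin N := ⟨1, by omega⟩
  set k₂ : Fin N := ⟨2, by omega⟩
  have hpencil : pencil M k₀ k₁ k₂ ≠ 0 := fun h => by
    simpa [pencil, Matrix.one_apply] using congrFun h 0
  obtain ⟨C, c, hc, hC⟩ := H _ hpencil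
  -- Inverting the `B k` recovers `Φ` from GHZ, so the pencil too becomes an image of GHZ.
  have hΦ : Φ = b • (tensorOp (fun k => (B k)⁻¹) *ᵥ ghz N d) := by
    rw [← Matrix.mulVec_smul, ← hB, Matrix.mulVec_mulVec, tensorOp_mul]
    simp only [fun k => Matrix.nonsing_inv_mul (B k) ((Matrix.isUnit_iff_isUnit_det _).1 (hunit k)),
      tensorOp_one, Matrix.one_mulVec]
  rw [hΦ, Matrix.mulVec_smul, Matrix.mulVec_mulVec, tensorOp_mul, ← eq_inv_smul_iff₀ hb,
    smul_smul] at hC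
  refine tensorOp_mulVec_ghz_ne_smul_pencil hd (by simp [k₀, k₁]) (by simp [k₀, k₂])
    (by simp [k₁, k₂]) (fun h => ?_) ?_ _ (mul_ne_zero (inv_ne_zero hb) hc) hC
  · simpa [hM] using congrFun (congrFun h 0) ⟨1, hd⟩
  · exact Matrix.single_mul_single_of_ne _ _ _ _ hone _

theorem mainTheorem3 (N d : ℕ) (hN : 3 ≤ N) (hd : 2 ≤ d) :
    ¬ ∃ Φ : MultiSpace (fun _ : Fin N => Fin d), ‖Φ‖ = 1 ∧
      (UniversalForDiscrimination (fun _ => d) Φ ∨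
        UniversalForUnambiguousDiscrimination (fun _ => d) Φ) := by
  rintro ⟨Φ, -, h⟩
  refine not_forall_exists_tensorOp_mulVec_eq_smul hN hd Φ.ofLp
    (exists_tensorOp_mulVec_eq_smul Φ fun n ψ i hψ => ?_)
  rcases h with h | h
  · obtain ⟨E, hE, hexp⟩ := h n ψ i.pos hψ
    exact ⟨_, _, _, E, i, hE, by simp [hexp], fun j hj => by rw [hexp, if_neg hj.symm]⟩
  · obtain ⟨E, ε, hE, hε, hexp⟩ := h n ψ hψ.1 hψ.linearIndependent
    exact ⟨_, _, _, E, some i, hE, by simpa [hexp] using hε i,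
      fun j hj => by rw [hexp, if_neg hj.symm]⟩
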